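/- Let $\alpha\in\mathbb{R}$ with $\alpha/\pi$ irrational, let $R_\alpha$ be the rotation of $\mathbb{R}^2$ by the angle $\alpha$, let $\overline e\in\mathbb{R}^2$ be a fixed unit vector, and let $\lambda>1$. Consider the iterated function system $\Phi_\lambda$ on $\mathbb{R}^2$ given by $$f_1(x)=(\lambda R_\alpha)^{-1}x,\qquad f_2(x)=x+\overline e,$$ the maps being chosen independently with probabilities $p_1=p_2=\tfrac12$. 1. For every $\lambda>1$ the system $\Phi_\lambda$ contracts on average, i.e. there is a constant $\chi<0$ such that, for almost every sequence $\omega\in\{1,2\}^{\mathbb N}$ with respect to the $(\tfrac12,\tfrac12)$ Bernoulli measure, $$\lim_{n\to\infty}\frac1n\log\|f_{\omega_0}\circ\dots\circ f_{\omega_{n-1}}\|=\chi,$$ where $\|g\|$ is the Lipschitz constant of $g$. There is a unique stationary Borel probability measure $\mu_\lambda$, i.e. a unique one with $\mu_\lambda=\tfrac12(f_1)_*\mu_\lambda+\tfrac12(f_2)_*\mu_\lambda$, and its support is full: $\operatorname{supp}(\mu_\lambda)=\mathbb{R}^2$. 2. If $\lambda>2$, then $\mu_\lambda$ is singular with respect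 to Lebesgue measure, and $$\dim_H(\mu_\lambda)\le\frac{2\log 2}{\log\lambda}<2,$$ where $\dim_H(\mu)$ is the infimum of the Hausdorff dimensions of the Borel sets of full $\mu$-measure. -/

import Mathlib

open MeasureTheory Filter Topology
open scoped NNReal ENNReal

noncomputable section

/-- The (least) Lipschitz constant of a map; it is `∞` if the map is not Lipschitz. -/
def lipConst {E : Type*} [PseudoEMetricSpace E] (g : E → E) : ℝ≥0∞ :=
  ⨅ (K : ℝ≥0) (_ : LipschitzWith K g), (K : ℝ≥0∞)

/-- The composition `f_{ω 0} ∘ f_{ω 1} ∘ ⋯ ∘ f_{ω (n - 1)}`. -/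
def ifsComp {ι E : Type*} (f : ι → E → E) (ω : ℕ → ι) : ℕ → E → E
  | 0 => id
  | n + 1 => ifsComp f ω n ∘ f (ω n)

/-- The Bernoulli (product) measure on `ι^ℕ` with marginals `p`. -/
def bernoulliSeq {ι : Type*} [MeasurableSpace ι] (p : PMF ι) : Measure (ℕ → ι) :=
  Measure.infinitePi fun _ : ℕ => p.toMeasure

/-- The IFS `f` with probabilities `p` contracts on average: the maps are Lipschitz and, almost
surely, `(1/n) log Lip(f_{ω 0} ∘ ⋯ ∘ f_{ω (n - 1)})` converges to a constant `χ < 0`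
(the Lyapunov exponent). The logarithm is extended-real-valued, with `log 0 = -∞`. -/
def ContractsOnAverage {ι E : Type*} [MeasurableSpace ι] [PseudoEMetricSpace E]
    (f : ι → E → E) (p : PMF ι) : Prop :=
  (∀ i, ∃ K : ℝ≥0, LipschitzWith K (f i)) ∧
    ∃ χ : ℝ, χ < 0 ∧ ∀ᵐ ω ∂(bernoulliSeq p),
      Tendsto (fun n : ℕ => ENNReal.log (lipConst (ifsComp f ω n)) / (n : EReal)) atTop
        (𝓝 (χ : EReal))

/-- `μ` is a stationary (invariant) probability measure of the IFS `f` with probabilities `p`: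
`μ = ∑ i, p i • (f i)_* μ`. -/
def IsStationaryMeasure {ι E : Type*} [Fintype ι] [MeasurableSpace E]
    (f : ι → E → E) (p : PMF ι) (μ : Measure E) : Prop :=
  IsProbabilityMeasure μ ∧ ∑ i, p i • μ.map (f i) = μ

/-- The Hausdorff dimension of a measure: the infimum of the Hausdorff dimensions of the
measurable sets of full measure. -/
def measureDimH {E : Type*} [EMetricSpace E] [MeasurableSpace E] (μ : Measure E) : ℝ≥0∞ :=
  ⨅ (S : Set E) (_ : MeasurableSet S) (_ : μ Sᶜ = 0), dimH S

/-- The matrix of the rotation of the plane by the angle `α`. -/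
def rotMatrix (α : ℝ) : Matrix (Fin 2) (Fin 2) ℝ :=
  !![Real.cos α, -Real.sin α; Real.sin α, Real.cos α]

/-- The planar IFS `f₁ x = (lam • R_α)⁻¹ x`, `f₂ x = x + e` (indexed by `0` and `1`). -/
def planarIFS (α lam : ℝ) (e : EuclideanSpace ℝ (Fin 2)) :
    Fin 2 → EuclideanSpace ℝ (Fin 2) → EuclideanSpace ℝ (Fin 2) :=
  ![fun x => Matrix.toEuclideanLin (lam • rotMatrix α)⁻¹ x, fun x => x + e]

end

/-!
A negative Lyapunov exponent makes the backward compositions `f_{ω 0} ∘ ⋯ ∘ f_{ω (n - 1)}` contract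
exponentially, so almost surely they converge to a point `Z ω` that does not depend on the starting
point. If `μ` is stationary then the `n`-th composition, applied to a `μ`-random point, again has
law `μ`; letting `n → ∞` shows that the law of `Z` is the only possible stationary measure, and it
is one because `Z (i, ω) = f i (Z ω)`.

For the dimension bound with `N` maps and Lyapunov exponent `χ`, take `θ ∈ (exp χ, 1)`. From some
time on, `Z ω` lies within `C θ ^ n` of one of the at most `N ^ n` images of a base point under
compositions of length `n`, so the law of `Z` is carried by a countable union of sets that have such
covers for all large `n`, and these have dimension at most `log N / -log θ`. Let `θ → exp χ`.

The support is closed and invariant under every map. In the complex plane the maps are `z ↦ ρ z`,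
with `ρ` non-real and `‖ρ‖ < 1`, and `z ↦ z + ε`. A nonempty closed set invariant under both
contains the closed additive semigroup `C` generated by the `ρ ^ n ε`, which contains arbitrarily
short nonzero vectors and hence, by compactness of the circle, a whole ray. The directions of rays
in `C` form a convex cone stable under `ρ`. Some power of `ρ` has nonpositive real part, so the cone
is symmetric; as `ρ` is non-real, it is the whole plane.
-/

variable {ι E : Type*}

section BernoulliSequences

variable [MeasurableSpace ι] {p : PMF ι}

instance isProbabilityMeasure_bernoulliSeq : IsProbabilityMeasure (bernoulliSeq p) := by
  unfold bernoulliSeq; infer_instance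

/-- The sequence with first term `i` followed by `ω`; it is a section of the one-sided shift over
the first coordinate. -/
def seqCons (i : ι) (ω : ℕ → ι) : ℕ → ι
  | 0 => i
  | n + 1 => ω n

theorem measurable_seqCons : Measurable fun x : ι × (ℕ → ι) => seqCons x.1 x.2 :=
  measurable_pi_lambda _ fun
    | 0 => measurable_fst
    | n + 1 => (measurable_pi_apply n).comp measurable_snd

theorem measurePreserving_seqCons :
    MeasurePreserving (fun x : ι × (ℕ → ι) => seqCons x.1 x.2)
      (p.toMeasure.prod (bernoulliSeq p)) (bernoulliSeq p) := by
  refine ⟨measurable_seqCons, Measure.eq_infinitePi _ fun s t ht => ?_⟩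
  set tail : Finset ℕ := s.preimage Nat.succ Nat.succ_injective.injOn with htail
  have hpre : (fun x : ι × (ℕ → ι) => seqCons x.1 x.2) ⁻¹' Set.pi s t =
      (if 0 ∈ s then t 0 else Set.univ) ×ˢ Set.pi tail fun n => t (n + 1) := by
    ext ⟨i, ω⟩
    have hsplit : (∀ n ∈ s, seqCons i ω n ∈ t n) ↔
        (0 ∈ s → i ∈ t 0) ∧ ∀ n, n + 1 ∈ s → ω n ∈ t (n + 1) :=
      Nat.and_forall_add_one.symm
    by_cases h0 : 0 ∈ s <;> simpa [htail, h0] using hsplit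
  have hprod : ∏ n ∈ s, p.toMeasure (t n) =
      (if 0 ∈ s then p.toMeasure (t 0) else 1) * ∏ n ∈ tail, p.toMeasure (t (n + 1)) := by
    classical
    rw [htail, Finset.prod_preimage' Nat.succ s _ fun n => p.toMeasure (t n),
      ← Finset.prod_filter_mul_prod_filter_not s (· = 0),
      Finset.filter_eq']
    congr 1
    · split_ifs <;> simp
    · simp [Nat.pos_iff_ne_zero]
  rw [Measure.map_apply measurable_seqCons (.pi s.countable_toSet fun n _ => ht n), hpre,
    Measure.prod_prod, hprod, bernoulliSeq, Measure.infinitePi_pi _ fun n _ => ht (n + 1)]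
  split_ifs <;> simp

theorem map_eval_bernoulliSeq (n : ℕ) : (bernoulliSeq p).map (fun ω => ω n) = p.toMeasure :=
  Measure.infinitePi_map_eval (fun _ => p.toMeasure) n

theorem ae_tendsto_average_bernoulliSeq [Fintype ι] [MeasurableSingletonClass ι] (g : ι → ℝ) :
    ∀ᵐ ω ∂bernoulliSeq p, Tendsto (fun n : ℕ => (∑ k ∈ Finset.range n, g (ω k)) / n) atTop
      (𝓝 (∑ i, (p i).toReal * g i)) := by
  have hg : Measurable g := measurable_of_finite g
  have hmap (n : ℕ) : (bernoulliSeq p).map (fun ω => g (ω n)) = p.toMeasure.map g := by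
    rw [← map_eval_bernoulliSeq n, Measure.map_map hg (measurable_pi_apply n)]
    rfl
  have hint : Integrable (fun ω => g (ω 0)) (bernoulliSeq p) :=
    (show MeasurePreserving (fun ω => ω 0) (bernoulliSeq p) p.toMeasure from
      ⟨measurable_pi_apply 0, map_eval_bernoulliSeq 0⟩).integrable_comp_of_integrable
      (g := g) .of_finite
  have hmean : ∫ ω, g (ω 0) ∂bernoulliSeq p = ∑ i, (p i).toReal * g i := by
    rw [← integral_map (φ := fun ω : ℕ → ι => ω 0) (measurable_pi_apply 0).aemeasurable
      hg.aestronglyMeasurable, map_eval_bernoulliSeq, PMF.integral_eq_sum]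
    simp only [smul_eq_mul]
  have hindep : ProbabilityTheory.iIndepFun (fun (n : ℕ) ω => g (ω n)) (bernoulliSeq p) :=
    ProbabilityTheory.iIndepFun_infinitePi fun _ => hg
  have hlaw := ProbabilityTheory.strong_law_ae_real (μ := bernoulliSeq p) (fun n ω => g (ω n)) hint
    (fun m n hmn => hindep.indepFun hmn)
    fun n => ⟨(hg.comp (measurable_pi_apply n)).aemeasurable,
      (hg.comp (measurable_pi_apply 0)).aemeasurable, by rw [hmap, hmap]⟩
  rwa [hmean] at hlaw

end BernoulliSequences

section LyapunovExponent

theorem lipschitzWith_of_lipConst_lt [PseudoEMetricSpace E] {g : E → E} {K : ℝ≥0}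
    (h : lipConst g < K) : LipschitzWith K g := by
  simp only [lipConst, iInf_lt_iff] at h
  obtain ⟨L, hL, hLK⟩ := h
  exact hL.weaken (by exact_mod_cast hLK.le)

theorem lipConst_eq_of_dist_eq [MetricSpace E] [Nontrivial E] {g : E → E} {c : ℝ≥0}
    (h : ∀ x y, dist (g x) (g y) = c * dist x y) : lipConst g = c := by
  have hg : LipschitzWith c g := .of_dist_le_mul fun x y => (h x y).le
  refine le_antisymm (iInf₂_le c hg) (le_iInf₂ fun K hK => ?_)
  obtain ⟨x, y, hxy⟩ := exists_pair_ne E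
  have hcK := hK.dist_le_mul x y
  rw [h] at hcK
  exact_mod_cast le_of_mul_le_mul_right hcK (dist_pos.2 hxy)

/-- The Lyapunov exponent of the random compositions `f_{ω 0} ∘ ⋯ ∘ f_{ω (n - 1)}` is `χ`: this is
the almost sure convergence in `ContractsOnAverage`, with the exponent named. -/
def HasLyapunovExponent [MeasurableSpace ι] [PseudoEMetricSpace E]
    (f : ι → E → E) (p : PMF ι) (χ : ℝ) : Prop :=
  ∀ᵐ ω ∂bernoulliSeq p,
    Tendsto (fun n : ℕ => ENNReal.log (lipConst (ifsComp f ω n)) / (n : EReal)) atTop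
      (𝓝 (χ : EReal))

theorem HasLyapunovExponent.ae_eventually_lipschitzWith [MeasurableSpace ι] [PseudoEMetricSpace E]
    {f : ι → E → E} {p : PMF ι} {χ : ℝ} (h : HasLyapunovExponent f p χ) {θ : ℝ≥0}
    (hθ : Real.exp χ < θ) :
    ∀ᵐ ω ∂bernoulliSeq p, ∀ᶠ n in atTop, LipschitzWith (θ ^ n) (ifsComp f ω n) := by
  have hθ0 : (0 : ℝ) < θ := (Real.exp_pos χ).trans hθ
  have hχ : (χ : EReal) < ENNReal.log θ := by
    rw [← ENNReal.ofReal_coe_nnreal, ENNReal.log_ofReal_of_pos hθ0]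
    exact_mod_cast (Real.lt_log_iff_exp_lt hθ0).2 hθ
  filter_upwards [h] with ω hω
  filter_upwards [hω.eventually_lt_const hχ, eventually_gt_atTop 0] with n hn hn0
  rw [EReal.div_lt_iff (by exact_mod_cast hn0) (EReal.natCast_ne_top n), mul_comm,
    ← ENNReal.log_pow, ENNReal.log_lt_log_iff] at hn
  exact lipschitzWith_of_lipConst_lt (by exact_mod_cast hn)

variable [MetricSpace E] {f : ι → E → E} {r : ι → ℝ≥0}

theorem dist_ifsComp (hf : ∀ i x y, dist (f i x) (f i y) = r i * dist x y)
    (ω : ℕ → ι) (n : ℕ) (x y : E) :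
    dist (ifsComp f ω n x) (ifsComp f ω n y) =
      (∏ k ∈ Finset.range n, r (ω k) : ℝ≥0) * dist x y := by
  induction n generalizing x y with
  | zero => simp [ifsComp]
  | succ n ih =>
    rw [ifsComp, Function.comp_apply, Function.comp_apply, ih, hf, Finset.prod_range_succ,
      NNReal.coe_mul, mul_assoc]

theorem hasLyapunovExponent_of_dist_eq [Nontrivial E] [Fintype ι] [MeasurableSpace ι]
    [MeasurableSingletonClass ι] (p : PMF ι) (hr : ∀ i, 0 < r i)
    (hf : ∀ i x y, dist (f i x) (f i y) = r i * dist x y) :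
    HasLyapunovExponent f p (∑ i, (p i).toReal * Real.log (r i)) := by
  filter_upwards [ae_tendsto_average_bernoulliSeq (p := p) fun i => Real.log (r i)] with ω hω
  refine ((continuous_coe_real_ereal.tendsto _).comp hω).congr fun n => ?_
  have hpos : 0 < ∏ k ∈ Finset.range n, r (ω k) := Finset.prod_pos fun k _ => hr (ω k)
  rw [lipConst_eq_of_dist_eq (dist_ifsComp hf ω n), ← ENNReal.ofReal_coe_nnreal,
    ENNReal.log_ofReal_of_pos (by exact_mod_cast hpos), NNReal.coe_prod,
    Real.log_prod fun k _ => by exact_mod_cast (hr (ω k)).ne', Function.comp_apply,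
    ← EReal.coe_natCast, ← EReal.coe_div]

end LyapunovExponent

section GeometricConvergence

variable [PseudoMetricSpace E] {u : ℕ → E} {C r : ℝ}

theorem cauchySeq_of_eventually_le_geometric (hr : r < 1)
    (h : ∀ᶠ n in atTop, dist (u n) (u (n + 1)) ≤ C * r ^ n) : CauchySeq u := by
  obtain ⟨N, hN⟩ := h.exists_forall_of_atTop
  refine (cauchySeq_shift N).1 (cauchySeq_of_le_geometric r (C * r ^ N) hr fun n => ?_)
  simpa only [add_right_comm, pow_add, mul_assoc, mul_comm] using hN (n + N) (N.le_add_left n)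

theorem eventually_dist_le_of_eventually_le_geometric (hr : r < 1)
    (h : ∀ᶠ n in atTop, dist (u n) (u (n + 1)) ≤ C * r ^ n) {l : E}
    (hl : Tendsto u atTop (𝓝 l)) : ∀ᶠ n in atTop, dist (u n) l ≤ C * r ^ n / (1 - r) := by
  filter_upwards [eventually_forall_ge_atTop.2 h] with N hN
  have hshift := dist_le_of_le_geometric_of_tendsto r (C * r ^ N) hr
    (f := fun n => u (n + N)) (fun n => ?_) ((tendsto_add_atTop_iff_nat N).2 hl) 0
  · simpa using hshift
  · simpa only [add_right_comm, pow_add, mul_assoc, mul_comm] using hN (n + N) (N.le_add_left n)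

theorem dist_ifsComp_succ_le_of_lipschitzWith [Fintype ι] {f : ι → E → E} {ω : ℕ → ι} {n : ℕ}
    {K : ℝ≥0} (h : LipschitzWith K (ifsComp f ω n)) (x : E) :
    dist (ifsComp f ω n x) (ifsComp f ω (n + 1) x) ≤ (∑ i, dist x (f i x)) * K :=
  calc dist (ifsComp f ω n x) (ifsComp f ω (n + 1) x)
      ≤ K * dist x (f (ω n) x) := h.dist_le_mul x (f (ω n) x)
    _ ≤ K * ∑ i, dist x (f i x) := by
      gcongr
      exact Finset.single_le_sum (f := fun i => dist x (f i x)) (fun _ _ => dist_nonneg)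
        (Finset.mem_univ _)
    _ = (∑ i, dist x (f i x)) * K := mul_comm _ _

end GeometricConvergence

section CodingMap

/-- `Z` is a coding map of the random IFS `(f, p)`: for almost every `ω` the backward compositions
`f_{ω 0} ∘ ⋯ ∘ f_{ω (n - 1)}` collapse every starting point to `Z ω`. -/
structure IsCodingMap [MeasurableSpace ι] [TopologicalSpace E] [MeasurableSpace E]
    (f : ι → E → E) (p : PMF ι) (Z : (ℕ → ι) → E) : Prop where
  measurable : Measurable Z
  ae_tendsto : ∀ᵐ ω ∂bernoulliSeq p, ∀ x, Tendsto (fun n => ifsComp f ω n x) atTop (𝓝 (Z ω))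

theorem ifsComp_seqCons (f : ι → E → E) (i : ι) (ω : ℕ → ι) (n : ℕ) :
    ifsComp f (seqCons i ω) (n + 1) = f i ∘ ifsComp f ω n := by
  induction n with
  | zero => rfl
  | succ n ih => rw [ifsComp, ih]; rfl

variable [MeasurableSpace ι] {f : ι → E → E} {p : PMF ι}

theorem measurable_ifsComp [Countable ι] [MeasurableSingletonClass ι] [MeasurableSpace E]
    (hf : ∀ i, Measurable (f i)) (n : ℕ) :
    Measurable fun x : (ℕ → ι) × E => ifsComp f x.1 n x.2 := by
  have hf' : Measurable fun x : ι × E => f x.1 x.2 := measurable_from_prod_countable_right hf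
  induction n with
  | zero => exact measurable_snd
  | succ n ih =>
    exact ih.comp (measurable_fst.prodMk
      (hf'.comp (((measurable_pi_apply n).comp measurable_fst).prodMk measurable_snd)))

theorem HasLyapunovExponent.exists_isCodingMap [Finite ι] [MeasurableSingletonClass ι]
    [PseudoMetricSpace E] [CompleteSpace E] [Nonempty E] [MeasurableSpace E] [BorelSpace E] {χ : ℝ}
    (h : HasLyapunovExponent f p χ) (hχ : χ < 0) (hf : ∀ i, Measurable (f i)) :
    ∃ Z, IsCodingMap f p Z := by
  have := Fintype.ofFinite ι
  obtain ⟨x₀⟩ := ‹Nonempty E›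
  obtain ⟨θ, hχθ, hθ⟩ := exists_between (Real.exp_lt_one_iff.2 hχ)
  lift θ to ℝ≥0 using (Real.exp_pos χ).le.trans hχθ.le
  have hlip := h.ae_eventually_lipschitzWith hχθ
  have hlim : ∀ᵐ ω ∂bernoulliSeq p, ∃ z, Tendsto (fun n => ifsComp f ω n x₀) atTop (𝓝 z) := by
    filter_upwards [hlip] with ω hω
    refine cauchySeq_tendsto_of_complete
      (cauchySeq_of_eventually_le_geometric (C := ∑ i, dist x₀ (f i x₀)) hθ ?_)
    filter_upwards [hω] with n hn
    exact_mod_cast dist_ifsComp_succ_le_of_lipschitzWith hn x₀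
  obtain ⟨Z, hZ, hZlim⟩ := measurable_limit_of_tendsto_metrizable_ae
    (fun n => ((measurable_ifsComp hf n).comp measurable_prodMk_right).aemeasurable) hlim
  refine ⟨Z, hZ, ?_⟩
  filter_upwards [hlip, hZlim] with ω hω hZω x
  refine tendsto_of_tendsto_of_dist hZω
    (squeeze_zero' (.of_forall fun _ => dist_nonneg) (hω.mono fun n hn => hn.dist_le_mul x₀ x) ?_)
  simpa using (tendsto_pow_atTop_nhds_zero_of_lt_one θ.2 hθ).mul_const (dist x₀ x)

theorem IsCodingMap.ae_apply_seqCons [TopologicalSpace E] [T2Space E] [MeasurableSpace E]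
    {Z : (ℕ → ι) → E} (hZ : IsCodingMap f p Z) (hf : ∀ i, Continuous (f i)) :
    ∀ᵐ x ∂p.toMeasure.prod (bernoulliSeq p), Z (seqCons x.1 x.2) = f x.1 (Z x.2) := by
  filter_upwards [measurePreserving_seqCons.quasiMeasurePreserving.ae hZ.ae_tendsto,
    Measure.quasiMeasurePreserving_snd.ae hZ.ae_tendsto] with ⟨i, ω⟩ hcons hω
  refine tendsto_nhds_unique ((tendsto_add_atTop_iff_nat 1).2 (hcons (Z ω))) ?_
  simpa only [ifsComp_seqCons, Function.comp_def] using ((hf i).tendsto (Z ω)).comp (hω (Z ω))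

end CodingMap

section StationaryMeasure

variable [Fintype ι] [MeasurableSpace ι] [MeasurableSingletonClass ι] [MeasurableSpace E]
  {f : ι → E → E} {p : PMF ι}

theorem map_prod_toMeasure_eq_sum {α : Type*} [MeasurableSpace α] (p : PMF ι) (ν : Measure α)
    [SFinite ν] {g : ι → α → E} (hg : ∀ i, Measurable (g i)) :
    (p.toMeasure.prod ν).map (fun x => g x.1 x.2) = ∑ i, p i • ν.map (g i) := by
  have hg' : Measurable fun x : ι × α => g x.1 x.2 := measurable_from_prod_countable_right hg
  ext B hB
  rw [Measure.map_apply hg' hB, Measure.prod_apply (hg' hB), lintegral_fintype,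
    Measure.finsetSum_apply]
  refine Finset.sum_congr rfl fun i _ => ?_
  rw [PMF.toMeasure_apply_singleton _ _ (.singleton i), Measure.smul_apply,
    Measure.map_apply (hg i) hB, mul_comm]
  rfl

theorem IsStationaryMeasure.measurePreserving {μ : Measure E} (hμ : IsStationaryMeasure f p μ)
    (hf : ∀ i, Measurable (f i)) :
    MeasurePreserving (fun x : ι × E => f x.1 x.2) (p.toMeasure.prod μ) μ := by
  have := hμ.1
  exact ⟨measurable_from_prod_countable_right hf,
    (map_prod_toMeasure_eq_sum p μ hf).trans hμ.2⟩

theorem IsStationaryMeasure.measurePreserving_ifsComp {μ : Measure E}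
    (hμ : IsStationaryMeasure f p μ) (hf : ∀ i, Measurable (f i)) (n : ℕ) :
    MeasurePreserving (fun x : (ℕ → ι) × E => ifsComp f x.1 n x.2) ((bernoulliSeq p).prod μ) μ := by
  have := hμ.1
  induction n with
  | zero => exact measurePreserving_snd
  | succ n ih =>
    have hcons := (measurePreserving_seqCons (p := p)).prod (.id μ)
    have hcomp := (hμ.measurePreserving hf).comp <|
      ((MeasurePreserving.id p.toMeasure).prod ih).comp <|
        measurePreserving_prodAssoc p.toMeasure (bernoulliSeq p) μ
    refine ⟨measurable_ifsComp hf (n + 1), ?_⟩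
    rw [← hcons.map_eq, Measure.map_map (measurable_ifsComp hf (n + 1)) hcons.measurable]
    refine Eq.trans ?_ hcomp.map_eq
    congr 1
    ext ⟨⟨i, ω⟩, x⟩
    exact congrFun (ifsComp_seqCons f i ω n) x

theorem map_eq_of_ae_tendsto_of_measurePreserving {Ω : Type*} [MeasurableSpace Ω]
    {P : Measure Ω} [IsProbabilityMeasure P] [TopologicalSpace E] [HasOuterApproxClosed E]
    [BorelSpace E] {μ : Measure E} {X : ℕ → Ω → E} {Z : Ω → E}
    (hX : ∀ n, MeasurePreserving (X n) P μ) (hZ : AEMeasurable Z P)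
    (hlim : ∀ᵐ ω ∂P, Tendsto (fun n => X n ω) atTop (𝓝 (Z ω))) : P.map Z = μ := by
  have hlaw : ∀ n, ProbabilityTheory.IdentDistrib (X 0) (X n) P P := fun n =>
    ⟨(hX 0).aemeasurable, (hX n).aemeasurable, by rw [(hX 0).map_eq, (hX n).map_eq]⟩
  rw [← (hX 0).map_eq]
  exact tendstoInDistribution_unique X
    (tendstoInDistribution_of_ae_tendsto (fun n => (hX n).aemeasurable) hZ hlim)
    (tendstoInDistribution_of_identDistrib 0 hlaw (hlaw 0))

variable [TopologicalSpace E] {Z : (ℕ → ι) → E}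

theorem IsCodingMap.isStationaryMeasure_map [T2Space E] [BorelSpace E] (hZ : IsCodingMap f p Z)
    (hf : ∀ i, Continuous (f i)) : IsStationaryMeasure f p ((bernoulliSeq p).map Z) := by
  refine ⟨Measure.isProbabilityMeasure_map hZ.measurable.aemeasurable, ?_⟩
  calc ∑ i, p i • ((bernoulliSeq p).map Z).map (f i)
      = ∑ i, p i • (bernoulliSeq p).map (f i ∘ Z) := by
        simp only [Measure.map_map (hf _).measurable hZ.measurable]
    _ = (p.toMeasure.prod (bernoulliSeq p)).map (fun x => f x.1 (Z x.2)) :=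
        (map_prod_toMeasure_eq_sum p (bernoulliSeq p) fun i =>
          (hf i).measurable.comp hZ.measurable).symm
    _ = (p.toMeasure.prod (bernoulliSeq p)).map (fun x => Z (seqCons x.1 x.2)) :=
        Measure.map_congr ((hZ.ae_apply_seqCons hf).mono fun _ hx => hx.symm)
    _ = (bernoulliSeq p).map Z := by
        conv_rhs => rw [← measurePreserving_seqCons.map_eq,
          Measure.map_map hZ.measurable measurable_seqCons]
        rfl

theorem IsStationaryMeasure.eq_map_codingMap [HasOuterApproxClosed E] [BorelSpace E] {μ : Measure E}
    (hμ : IsStationaryMeasure f p μ) (hZ : IsCodingMap f p Z) (hf : ∀ i, Measurable (f i)) :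
    μ = (bernoulliSeq p).map Z := by
  have := hμ.1
  have hlim : ∀ᵐ x ∂(bernoulliSeq p).prod μ,
      Tendsto (fun n => ifsComp f x.1 n x.2) atTop (𝓝 (Z x.1)) :=
    (Measure.quasiMeasurePreserving_fst.ae hZ.ae_tendsto).mono fun x hx => hx x.2
  rw [← map_eq_of_ae_tendsto_of_measurePreserving (hμ.measurePreserving_ifsComp hf)
      (hZ.measurable.comp measurable_fst).aemeasurable hlim]
  change ((bernoulliSeq p).prod μ).map (Z ∘ Prod.fst) = _
  rw [← Measure.map_map hZ.measurable measurable_fst, measurePreserving_fst.map_eq]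

end StationaryMeasure

theorem existsUnique_isStationaryMeasure [Fintype ι] [MeasurableSpace ι]
    [MeasurableSingletonClass ι] [MetricSpace E] [CompleteSpace E] [Nonempty E] [MeasurableSpace E]
    [BorelSpace E] {f : ι → E → E} {p : PMF ι} (h : ContractsOnAverage f p) :
    ∃! μ, IsStationaryMeasure f p μ := by
  obtain ⟨hlip, χ, hχ, hlyap⟩ := h
  have hf : ∀ i, Continuous (f i) := fun i => (hlip i).choose_spec.continuous
  obtain ⟨Z, hZ⟩ := HasLyapunovExponent.exists_isCodingMap hlyap hχ fun i => (hf i).measurable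
  exact ⟨_, hZ.isStationaryMeasure_map hf,
    fun μ hμ => hμ.eq_map_codingMap hZ fun i => (hf i).measurable⟩

section HausdorffDimension

open Module Metric

theorem ediam_closedBall_le [PseudoMetricSpace E] (x : E) (r : ℝ≥0) :
    ediam (closedBall x r) ≤ (2 * r : ℝ≥0) := by
  rw [← closedEBall_coe, ENNReal.coe_mul]
  exact ediam_closedEBall_le

theorem sum_ediam_closedBall_rpow_le [PseudoMetricSpace E] {t : Finset E} {N C θ s : ℝ≥0} {n : ℕ}
    (hcard : (t.card : ℝ≥0) ≤ N ^ n) (hN : N * θ ^ (s : ℝ) ≤ 1) :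
    ∑ x : t, ediam (closedBall (x : E) (C * θ ^ n : ℝ≥0)) ^ (s : ℝ) ≤
      ((2 * C) ^ (s : ℝ) : ℝ≥0) :=
  calc ∑ x : t, ediam (closedBall (x : E) (C * θ ^ n : ℝ≥0)) ^ (s : ℝ)
      ≤ ∑ _x : t, ((2 * (C * θ ^ n) : ℝ≥0) : ℝ≥0∞) ^ (s : ℝ) := by
        gcongr
        exact ediam_closedBall_le _ _
    _ = (t.card * (2 * (C * θ ^ n)) ^ (s : ℝ) : ℝ≥0) := by
        simp [ENNReal.coe_rpow_of_nonneg]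
    _ ≤ (N ^ n * (2 * (C * θ ^ n)) ^ (s : ℝ) : ℝ≥0) := by
        gcongr
    _ = ((2 * C) ^ (s : ℝ) * (N * θ ^ (s : ℝ)) ^ n : ℝ≥0) := by
        rw [← mul_assoc, NNReal.mul_rpow, mul_pow, ← NNReal.rpow_natCast (θ ^ (s : ℝ)),
          ← NNReal.rpow_mul, mul_comm (s : ℝ), NNReal.rpow_mul, NNReal.rpow_natCast,
          mul_left_comm]
    _ ≤ ((2 * C) ^ (s : ℝ) : ℝ≥0) := by
        exact_mod_cast mul_le_of_le_one_right' (pow_le_one' hN n)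

theorem dimH_le_of_eventually_subset_closedBall [MetricSpace E] {F : Set E} {t : ℕ → Finset E}
    {N C θ s : ℝ≥0} (hθ : θ < 1) (hcard : ∀ n, ((t n).card : ℝ≥0) ≤ N ^ n)
    (hN : N * θ ^ (s : ℝ) ≤ 1)
    (hF : ∀ᶠ n in atTop, F ⊆ ⋃ x ∈ t n, closedBall x (C * θ ^ n : ℝ≥0)) : dimH F ≤ s := by
  borelize E
  have hradius : Tendsto (fun n : ℕ => ((2 * (C * θ ^ n) : ℝ≥0) : ℝ≥0∞)) atTop (𝓝 0) := by
    rw [← ENNReal.coe_zero, ENNReal.tendsto_coe]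
    simpa using ((NNReal.tendsto_pow_atTop_nhds_zero_of_lt_one hθ).const_mul C).const_mul 2
  have hliminf := Measure.hausdorffMeasure_le_liminf_sum (s : ℝ) F _ hradius
    (fun n (x : t n) => closedBall (x : E) (C * θ ^ n : ℝ≥0))
    (.of_forall fun _ x => ediam_closedBall_le (x : E) _)
    (by simpa only [Set.iUnion_subtype] using hF)
  have hbound : Measure.hausdorffMeasure (s : ℝ) F ≤ ((2 * C) ^ (s : ℝ) : ℝ≥0) :=
    hliminf.trans <| liminf_le_of_frequently_le' <| .of_forall fun n =>
      sum_ediam_closedBall_rpow_le (hcard n) hN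
  exact dimH_le_of_hausdorffMeasure_ne_top (ne_top_of_le_ne_top ENNReal.coe_ne_top hbound)

theorem exists_finset_card_le_forall_ifsComp_mem [Fintype ι] (f : ι → E → E) (n : ℕ) (x : E) :
    ∃ t : Finset E, t.card ≤ Fintype.card ι ^ n ∧ ∀ ω, ifsComp f ω n x ∈ t := by
  classical
  induction n generalizing x with
  | zero => exact ⟨{x}, by simp, fun _ => Finset.mem_singleton_self x⟩
  | succ n ih =>
    choose t hcard ht using ih
    refine ⟨Finset.univ.biUnion fun i => t (f i x), ?_, fun ω =>
      Finset.mem_biUnion.2 ⟨ω n, Finset.mem_univ _, ht (f (ω n) x) ω⟩⟩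
    rw [pow_succ']
    exact Finset.card_biUnion_le_card_mul _ _ _ fun i _ => hcard (f i x)

section CodingMap

variable [MeasurableSpace ι] [MetricSpace E] [MeasurableSpace E]
  {f : ι → E → E} {p : PMF ι} {χ : ℝ} {θ : ℝ≥0} {Z : (ℕ → ι) → E}

theorem IsCodingMap.exists_ae_eventually_dist_le [Finite ι] (hZ : IsCodingMap f p Z)
    (h : HasLyapunovExponent f p χ) (hχ : Real.exp χ < θ) (hθ : θ < 1) (x : E) :
    ∃ C : ℝ≥0, ∀ᵐ ω ∂bernoulliSeq p, ∀ᶠ n in atTop, dist (Z ω) (ifsComp f ω n x) ≤ C * θ ^ n := by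
  have := Fintype.ofFinite ι
  have hC : 0 ≤ (∑ i, dist x (f i x)) / (1 - θ) :=
    div_nonneg (Finset.sum_nonneg fun _ _ => dist_nonneg) (sub_nonneg.2 (by exact_mod_cast hθ.le))
  refine ⟨⟨_, hC⟩, ?_⟩
  filter_upwards [h.ae_eventually_lipschitzWith hχ, hZ.ae_tendsto] with ω hlip hω
  have hstep : ∀ᶠ n in atTop, dist (ifsComp f ω n x) (ifsComp f ω (n + 1) x) ≤
      (∑ i, dist x (f i x)) * θ ^ n := hlip.mono fun n hn => by
    exact_mod_cast dist_ifsComp_succ_le_of_lipschitzWith hn x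
  filter_upwards [eventually_dist_le_of_eventually_le_geometric hθ hstep (hω x)] with n hn
  rw [dist_comm]
  exact hn.trans_eq (mul_div_right_comm _ _ _)

theorem IsCodingMap.measureDimH_map_le [Fintype ι] [BorelSpace E] (hZ : IsCodingMap f p Z)
    (h : HasLyapunovExponent f p χ) (hχ : Real.exp χ < θ) (hθ : θ < 1) {s : ℝ≥0}
    (hs : Fintype.card ι * θ ^ (s : ℝ) ≤ 1) : measureDimH ((bernoulliSeq p).map Z) ≤ s := by
  obtain ⟨ω₀, -⟩ := hZ.ae_tendsto.exists
  obtain ⟨C, hC⟩ := hZ.exists_ae_eventually_dist_le h hχ hθ (Z ω₀)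
  choose t hcard ht using fun n => exists_finset_card_le_forall_ifsComp_mem f n (Z ω₀)
  let cover (n : ℕ) : Set E := ⋃ x ∈ t n, closedBall x (C * θ ^ n : ℝ≥0)
  let S : Set E := ⋃ M, ⋂ n ≥ M, cover n
  have hS : MeasurableSet S := .iUnion fun M => .iInter fun n => .iInter fun _ =>
    (t n).measurableSet_biUnion fun _ _ => measurableSet_closedBall
  have hZS : ∀ᵐ ω ∂bernoulliSeq p, Z ω ∈ S := by
    filter_upwards [hC] with ω hω
    obtain ⟨M, hM⟩ := eventually_atTop.1 hω
    exact Set.mem_iUnion.2 ⟨M, Set.mem_iInter₂.2 fun n hn => Set.mem_iUnion₂.2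
      ⟨_, ht n ω, hM n hn⟩⟩
  refine iInf_le_of_le S (iInf₂_le_of_le hS ((ae_map_iff hZ.measurable.aemeasurable hS).2 hZS) ?_)
  rw [dimH_iUnion]
  refine iSup_le fun M => dimH_le_of_eventually_subset_closedBall (t := t) (C := C) hθ
    (fun n => by exact_mod_cast hcard n) hs ?_
  filter_upwards [eventually_ge_atTop M] with n hn using Set.iInter₂_subset n hn

theorem IsStationaryMeasure.measureDimH_le [Fintype ι] [MeasurableSingletonClass ι]
    [CompleteSpace E] [BorelSpace E] {μ : Measure E} (hμ : IsStationaryMeasure f p μ)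
    (h : HasLyapunovExponent f p χ) (hχ : χ < 0) (hf : ∀ i, Measurable (f i)) :
    measureDimH μ ≤ ENNReal.ofReal (Real.log (Fintype.card ι) / -χ) := by
  have := hμ.1
  have := μ.nonempty_of_neZero
  have : Nonempty ι := p.support_nonempty.to_type
  obtain ⟨Z, hZ⟩ := h.exists_isCodingMap hχ hf
  have hlim : Tendsto (fun a => ENNReal.ofReal (Real.log (Fintype.card ι) / a)) (𝓝[<] (-χ))
      (𝓝 (ENNReal.ofReal (Real.log (Fintype.card ι) / -χ))) :=
    ENNReal.tendsto_ofReal (tendsto_const_nhds.div (tendsto_id.mono_left nhdsWithin_le_nhds)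
      (neg_pos.2 hχ).ne')
  refine ge_of_tendsto hlim ?_
  filter_upwards [Ioo_mem_nhdsLT (neg_pos.2 hχ)] with a ⟨ha, haχ⟩
  have hs : 0 ≤ Real.log (Fintype.card ι) / a := div_nonneg (Real.log_natCast_nonneg _) ha.le
  have hθ : ((Real.exp (-a)).toNNReal : ℝ) = Real.exp (-a) :=
    Real.coe_toNNReal _ (Real.exp_pos _).le
  rw [hμ.eq_map_codingMap hZ hf]
  refine hZ.measureDimH_map_le h (by rw [hθ]; exact Real.exp_lt_exp.2 (lt_neg_of_lt_neg haχ))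
    (Real.toNNReal_lt_one.2 (Real.exp_lt_one_iff.2 (neg_neg_of_pos ha))) (le_of_eq ?_)
  rw [← NNReal.coe_inj]
  push_cast
  rw [hθ, Real.coe_toNNReal _ hs, ← Real.exp_mul, neg_mul, mul_div_cancel₀ _ ha.ne', Real.exp_neg,
    Real.exp_log (by exact_mod_cast Fintype.card_pos), mul_inv_cancel₀ (by simp)]

end CodingMap

theorem mutuallySingular_of_measureDimH_lt_finrank [NormedAddCommGroup E] [NormedSpace ℝ E]
    [FiniteDimensional ℝ E] [MeasurableSpace E] [BorelSpace E] {μ ν : Measure E}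
    [ν.IsAddHaarMeasure] (h : measureDimH μ < finrank ℝ E) : μ ⟂ₘ ν := by
  simp only [measureDimH, iInf_lt_iff] at h
  obtain ⟨S, hS, hμS, hdim⟩ := h
  have hac : ν ≪ Measure.hausdorffMeasure ((finrank ℝ E : ℝ≥0) : ℝ) := by
    rw [NNReal.coe_natCast]
    exact Measure.absolutelyContinuous_isAddHaarMeasure _ _
  refine ⟨Sᶜ, hS.compl, hμS, ?_⟩
  rw [compl_compl]
  exact measure_zero_of_dimH_lt hac hdim

end HausdorffDimension

theorem IsStationaryMeasure.map_mem_support [Fintype ι] [TopologicalSpace E] [MeasurableSpace E]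
    [BorelSpace E] {f : ι → E → E} {p : PMF ι} {μ : Measure E} (hμ : IsStationaryMeasure f p μ)
    {i : ι} (hi : p i ≠ 0) (hf : Continuous (f i)) {x : E} (hx : x ∈ μ.support) :
    f i x ∈ μ.support := by
  rw [Measure.mem_support_iff_forall] at hx ⊢
  intro U hU
  calc 0 < p i * μ (f i ⁻¹' U) :=
        ENNReal.mul_pos hi (hx _ (hf.continuousAt.preimage_mem_nhds hU)).ne'
    _ ≤ p i * μ.map (f i) U :=
        mul_le_mul_right (Measure.le_map_apply hf.aemeasurable U) _
    _ ≤ ∑ j, p j * μ.map (f j) U :=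
        Finset.single_le_sum (f := fun j => p j * μ.map (f j) U) (fun _ _ => zero_le)
          (Finset.mem_univ i)
    _ = (∑ j, p j • μ.map (f j)) U := by simp [Measure.finsetSum_apply]
    _ = μ U := by rw [hμ.2]

section PlanarSemigroups

theorem two_pow_mul_abs_im_lt_re {z : ℂ} (hz : ∀ m, 0 < (z ^ m).re) (k : ℕ) :
    2 ^ k * |z.im| < z.re := by
  have hre : 0 < z.re := by simpa using hz 1
  have hsq : 0 < z.re * z.re - z.im * z.im := by simpa [pow_two] using hz 2
  induction k generalizing z with
  | zero => simpa [abs_of_pos hre] using sq_lt_sq.1 (by nlinarith : z.im ^ 2 < z.re ^ 2)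
  | succ k ih =>
    have hz2 : ∀ m, 0 < ((z ^ 2) ^ m).re := fun m => by simpa only [pow_mul] using hz (2 * m)
    have hdouble := ih hz2 (by simpa using hz2 1) (by simpa [pow_two] using hz2 2)
    have him : (z ^ 2).im = 2 * z.re * z.im := by simp [pow_two]; ring
    have hre2 : (z ^ 2).re = z.re * z.re - z.im * z.im := by simp [pow_two]
    rw [him, hre2, abs_mul, abs_of_pos (by positivity : 0 < 2 * z.re)] at hdouble
    refine lt_of_mul_lt_mul_left ?_ hre.le
    calc z.re * (2 ^ (k + 1) * |z.im|) = 2 ^ k * (2 * z.re * |z.im|) := by ring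
      _ < z.re * z.re - z.im * z.im := hdouble
      _ ≤ z.re * z.re := sub_le_self _ (mul_self_nonneg _)

theorem exists_re_pow_nonpos {z : ℂ} (hz : z.im ≠ 0) : ∃ m, (z ^ m).re ≤ 0 := by
  by_contra! hpos
  obtain ⟨k, hk⟩ := pow_unbounded_of_one_lt (z.re / |z.im|) one_lt_two
  exact ((div_lt_iff₀ (abs_pos.2 hz)).1 hk).not_gt (two_pow_mul_abs_im_lt_re hpos k)

theorem ofReal_mul_mem {D : Submodule ℝ≥0 ℂ} {c : ℝ} (hc : 0 ≤ c) {x : ℂ} (hx : x ∈ D) :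
    c * x ∈ D := by
  lift c to ℝ≥0 using hc
  exact D.smul_mem c hx

theorem neg_mem_of_mul_mem_of_re_nonpos {D : Submodule ℝ≥0 ℂ} {q : ℂ} (hq : q ≠ 0)
    (hre : q.re ≤ 0) (hmul : ∀ x ∈ D, q * x ∈ D) {x : ℂ} (hx : x ∈ D) : -x ∈ D := by
  have hn : (Complex.normSq q : ℂ) ≠ 0 := by exact_mod_cast (Complex.normSq_pos.2 hq).ne'
  -- `q` is a root of `X ^ 2 - 2 * q.re * X + ‖q‖ ^ 2`, whose middle coefficient is nonnegative.
  have hroot : q * q + (-2 * q.re : ℝ) * q = -Complex.normSq q := by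
    apply Complex.ext <;> simp [Complex.normSq_apply] <;> ring
  have hneg : ((Complex.normSq q)⁻¹ : ℝ) * (q * (q * x) + (-2 * q.re : ℝ) * (q * x)) = -x := by
    rw [← mul_assoc q, ← mul_assoc _ q, ← add_mul, hroot, Complex.ofReal_inv, neg_mul,
      mul_neg, inv_mul_cancel_left₀ hn]
  rw [← hneg]
  exact ofReal_mul_mem (inv_nonneg.2 (Complex.normSq_nonneg q)) <|
    D.add_mem (hmul _ (hmul x hx)) (ofReal_mul_mem (by linarith) (hmul x hx))

theorem eq_top_of_mul_mem_of_im_ne_zero {D : Submodule ℝ≥0 ℂ} (hD : D ≠ ⊥) {ρ : ℂ}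
    (hρ : ρ.im ≠ 0) (hmul : ∀ x ∈ D, ρ * x ∈ D) : D = ⊤ := by
  have hpow (m : ℕ) : ∀ x ∈ D, ρ ^ m * x ∈ D := by
    induction m with
    | zero => simp
    | succ m ih => exact fun x hx => by simpa only [pow_succ, mul_assoc] using ih _ (hmul x hx)
  obtain ⟨m, hm⟩ := exists_re_pow_nonpos hρ
  have hρ0 : ρ ≠ 0 := fun h => hρ (by simp [h])
  have hreal (c : ℝ) {x : ℂ} (hx : x ∈ D) : c * x ∈ D := by
    obtain hc | hc := le_total 0 c
    · exact ofReal_mul_mem hc hx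
    · have hneg := neg_mem_of_mul_mem_of_re_nonpos (pow_ne_zero m hρ0) hm (hpow m) hx
      simpa using ofReal_mul_mem (neg_nonneg.2 hc) hneg
  obtain ⟨x, hx, hx0⟩ := D.ne_bot_iff.1 hD
  refine D.eq_top_iff'.2 fun w => ?_
  have hw : w / x = ((w / x).re - (w / x).im / ρ.im * ρ.re : ℝ) + ((w / x).im / ρ.im : ℝ) * ρ := by
    apply Complex.ext <;> simp [hρ]
  rw [← div_mul_cancel₀ w hx0, hw, add_mul, mul_assoc]
  exact D.add_mem (hreal _ hx) (hreal _ (hmul x hx))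

/-- The recession cone of an additive submonoid of a real vector space: all directions `x` whose
ray `{t • x | 0 ≤ t}` stays in `C`. -/
def recessionCone [AddCommMonoid E] [Module ℝ≥0 E] (C : AddSubmonoid E) :
    Submodule ℝ≥0 E where
  carrier := {x | ∀ t : ℝ≥0, t • x ∈ C}
  add_mem' hx hy t := by simpa only [smul_add] using C.add_mem (hx t) (hy t)
  zero_mem' t := by simpa only [smul_zero] using C.zero_mem
  smul_mem' c x hx t := by simpa only [smul_smul] using hx (t * c)

variable [NormedAddCommGroup E] [NormedSpace ℝ E] {C : AddSubmonoid E} {v : ℕ → E}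

theorem mem_of_tendsto_smul_of_tendsto_zero (hC : IsClosed (C : Set E)) (hv : ∀ n, v n ∈ C)
    (hlim : Tendsto v atTop (𝓝 0)) {a : ℕ → ℝ≥0} {d : E}
    (had : Tendsto (fun n => a n • v n) atTop (𝓝 d)) : d ∈ C := by
  have hfract : Tendsto (fun n => (a n - ⌊a n⌋₊ : ℝ) • v n) atTop (𝓝 0) := by
    refine squeeze_zero_norm (fun n => ?_) (tendsto_zero_iff_norm_tendsto_zero.1 hlim)
    rw [norm_smul, Real.norm_of_nonneg (sub_nonneg.2 (by exact_mod_cast Nat.floor_le zero_le))]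
    refine mul_le_of_le_one_left (norm_nonneg _) (sub_le_iff_le_add'.2 ?_)
    exact_mod_cast (Nat.lt_floor_add_one (a n)).le
  refine hC.mem_of_tendsto (f := fun n => ⌊a n⌋₊ • v n) (b := atTop) ?_
    (.of_forall fun n => C.nsmul_mem (hv n) _)
  simpa [sub_smul, NNReal.smul_def, Nat.cast_smul_eq_nsmul] using had.sub hfract

theorem recessionCone_ne_bot_of_tendsto_zero [ProperSpace E] (hC : IsClosed (C : Set E))
    (hv : ∀ n, v n ∈ C) (hv0 : ∀ n, v n ≠ 0) (hlim : Tendsto v atTop (𝓝 0)) :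
    recessionCone C ≠ ⊥ := by
  have hunit : ∀ n, ‖v n‖₊⁻¹ • v n ∈ Metric.sphere (0 : E) 1 := fun n => by
    simp [NNReal.smul_def, norm_smul, hv0 n]
  obtain ⟨d, hd, k, hk, hkd⟩ := (isCompact_sphere (0 : E) 1).tendsto_subseq hunit
  refine (recessionCone C).ne_bot_iff.2 ⟨d, fun t => ?_, ne_zero_of_mem_unit_sphere ⟨d, hd⟩⟩
  refine mem_of_tendsto_smul_of_tendsto_zero (a := fun n => t * ‖v (k n)‖₊⁻¹) hC
    (fun n => hv (k n)) (hlim.comp hk.tendsto_atTop) ?_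
  simpa only [smul_smul, Function.comp_def] using hkd.const_smul t

theorem eq_top_of_isClosed_of_mul_mem {C : AddSubmonoid ℂ} (hC : IsClosed (C : Set ℂ))
    (hbot : C ≠ ⊥) {ρ : ℂ} (hρ : ‖ρ‖ < 1) (him : ρ.im ≠ 0) (hmul : ∀ z ∈ C, ρ * z ∈ C) : C = ⊤ := by
  obtain ⟨ε, hε, hε0⟩ := C.bot_or_exists_ne_zero.resolve_left hbot
  have hρ0 : ρ ≠ 0 := fun h => him (by simp [h])
  have horbit (n : ℕ) : ρ ^ n * ε ∈ C := by
    induction n with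
    | zero => simpa using hε
    | succ n ih => simpa only [pow_succ', mul_assoc] using hmul _ ih
  have hcone : recessionCone C = ⊤ :=
    eq_top_of_mul_mem_of_im_ne_zero
      (recessionCone_ne_bot_of_tendsto_zero hC horbit
        (fun n => mul_ne_zero (pow_ne_zero n hρ0) hε0)
        (by simpa using (tendsto_pow_atTop_nhds_zero_of_norm_lt_one hρ).mul_const ε))
      him fun x hx t => by simpa only [mul_smul_comm] using hmul _ (hx t)
  refine eq_top_iff.2 fun z _ => ?_
  have hz : z ∈ recessionCone C := hcone ▸ Submodule.mem_top
  simpa using hz 1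

theorem aeval_mul_mem_of_mul_mem_of_add_mem {R : Type*} [CommSemiring R] {T : Set R} {ρ ε : R}
    (h0 : 0 ∈ T) (hmul : ∀ z ∈ T, ρ * z ∈ T) (hadd : ∀ z ∈ T, z + ε ∈ T) (q : Polynomial ℕ) :
    Polynomial.aeval ρ q * ε ∈ T := by
  have hnsmul (k : ℕ) : ∀ z ∈ T, z + k * ε ∈ T := by
    induction k with
    | zero => simp
    | succ k ih => exact fun z hz => by simpa [add_mul, add_assoc] using hadd _ (ih z hz)
  induction q using Polynomial.recOnHorner with
  | M0 => simpa using h0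
  | MC q k _ _ ih => simpa [add_mul] using hnsmul k _ ih
  | MX q _ ih => simpa [mul_assoc, mul_comm, mul_left_comm] using hmul _ ih

theorem eq_univ_of_mul_mem_of_add_mem {T : Set ℂ} (hT : IsClosed T) (hne : T.Nonempty)
    {ρ ε : ℂ} (hρ : ‖ρ‖ < 1) (him : ρ.im ≠ 0) (hε : ε ≠ 0)
    (hmul : ∀ z ∈ T, ρ * z ∈ T) (hadd : ∀ z ∈ T, z + ε ∈ T) : T = Set.univ := by
  have h0 : (0 : ℂ) ∈ T := by
    obtain ⟨x, hx⟩ := hne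
    refine hT.mem_of_tendsto (f := fun n : ℕ => (ρ * ·)^[n] x) (b := atTop) ?_
      (.of_forall fun n => Set.MapsTo.iterate hmul n hx)
    simpa [mul_left_iterate] using
      (tendsto_pow_atTop_nhds_zero_of_norm_lt_one hρ).mul_const x
  let S : AddSubmonoid ℂ := AddMonoidHom.mrange
    ((AddMonoidHom.mulRight ε).comp (Polynomial.aeval (R := ℕ) ρ).toRingHom.toAddMonoidHom)
  have hST : (S : Set ℂ) ⊆ T := by
    rintro _ ⟨q, rfl⟩
    exact aeval_mul_mem_of_mul_mem_of_add_mem h0 hmul hadd q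
  have hS : ∀ z ∈ S, ρ * z ∈ S := by
    rintro _ ⟨q, rfl⟩
    exact ⟨Polynomial.X * q, by simp [mul_assoc]⟩
  have hεS : ε ∈ S := ⟨1, by simp⟩
  have htop : S.topologicalClosure = ⊤ :=
    eq_top_of_isClosed_of_mul_mem S.isClosed_topologicalClosure
      (fun h => hε ((AddSubmonoid.mem_bot).1 (h ▸ S.le_topologicalClosure hεS)))
      hρ him fun z hz => map_mem_closure (continuous_const_mul ρ) hz hS
  refine Set.eq_univ_of_univ_subset ?_
  calc Set.univ = (S.topologicalClosure : Set ℂ) := by rw [htop, AddSubmonoid.coe_top]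
    _ ⊆ T := closure_minimal hST hT

end PlanarSemigroups

section PlanarIFS

/-- The complex number `lam⁻¹ * exp (-α * I)`. Under the isometry
`Complex.orthonormalBasisOneI.repr` between `ℂ` and the Euclidean plane, multiplication by it is the
linear map of `planarIFS`. -/
noncomputable def planarMultiplier (α lam : ℝ) : ℂ :=
  (lam⁻¹ : ℝ) * Complex.exp ((-α : ℝ) * Complex.I)

variable {α lam : ℝ} {e : EuclideanSpace ℝ (Fin 2)}

theorem norm_planarMultiplier (hlam : 0 ≤ lam) : ‖planarMultiplier α lam‖ = lam⁻¹ := by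
  rw [planarMultiplier, norm_mul, Complex.norm_exp_ofReal_mul_I, mul_one, Complex.norm_real,
    Real.norm_of_nonneg (inv_nonneg.2 hlam)]

theorem planarMultiplier_im_ne_zero (hlam : lam ≠ 0) (hα : Real.sin α ≠ 0) :
    (planarMultiplier α lam).im ≠ 0 := by
  rw [planarMultiplier, Complex.im_ofReal_mul, Complex.exp_ofReal_mul_I_im, Real.sin_neg]
  exact mul_ne_zero (inv_ne_zero hlam) (neg_ne_zero.2 hα)

theorem inv_smul_rotMatrix (hlam : lam ≠ 0) :
    (lam • rotMatrix α)⁻¹ = lam⁻¹ • rotMatrix (-α) := by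
  have hrot : rotMatrix α * rotMatrix (-α) = 1 := by
    ext i j
    fin_cases i <;> fin_cases j <;> simp [rotMatrix, Matrix.mul_apply, ← sq, mul_comm]
  exact Matrix.inv_eq_right_inv (by rw [smul_mul_smul_comm, mul_inv_cancel₀ hlam, hrot, one_smul])

theorem toEuclideanLin_rotMatrix_repr (α : ℝ) (z : ℂ) :
    Matrix.toEuclideanLin (rotMatrix α) (Complex.orthonormalBasisOneI.repr z) =
      Complex.orthonormalBasisOneI.repr (Complex.exp (α * Complex.I) * z) := by
  ext i
  fin_cases i <;>
    simp [Matrix.toLpLin_apply, rotMatrix, Complex.exp_ofReal_mul_I_re,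
      Complex.exp_ofReal_mul_I_im] <;> ring

theorem planarIFS_zero_repr (hlam : lam ≠ 0) (z : ℂ) :
    planarIFS α lam e 0 (Complex.orthonormalBasisOneI.repr z) =
      Complex.orthonormalBasisOneI.repr (planarMultiplier α lam * z) := by
  change Matrix.toEuclideanLin (lam • rotMatrix α)⁻¹ _ = _
  rw [inv_smul_rotMatrix hlam, map_smul, LinearMap.smul_apply, toEuclideanLin_rotMatrix_repr,
    ← map_smul, Complex.real_smul, ← mul_assoc, planarMultiplier]

theorem dist_planarIFS (hlam : 0 < lam) (i : Fin 2) (x y : EuclideanSpace ℝ (Fin 2)) :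
    dist (planarIFS α lam e i x) (planarIFS α lam e i y) =
      (![lam.toNNReal⁻¹, 1] i : ℝ≥0) * dist x y := by
  obtain ⟨z, rfl⟩ := Complex.orthonormalBasisOneI.repr.surjective x
  obtain ⟨w, rfl⟩ := Complex.orthonormalBasisOneI.repr.surjective y
  fin_cases i
  · change dist (planarIFS α lam e 0 _) (planarIFS α lam e 0 _) = _
    rw [planarIFS_zero_repr hlam.ne', planarIFS_zero_repr hlam.ne', LinearIsometryEquiv.dist_map,
      LinearIsometryEquiv.dist_map, dist_eq_norm, ← mul_sub, norm_mul,
      norm_planarMultiplier hlam.le]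
    simp [dist_eq_norm, hlam.le]
  · simp [planarIFS]

theorem continuous_planarIFS (hlam : 0 < lam) (i : Fin 2) : Continuous (planarIFS α lam e i) :=
  (LipschitzWith.of_dist_le_mul fun x y => (dist_planarIFS hlam i x y).le).continuous

theorem hasLyapunovExponent_planarIFS (hlam : 0 < lam) :
    HasLyapunovExponent (planarIFS α lam e) (PMF.uniformOfFintype (Fin 2))
      (-(Real.log lam / 2)) := by
  have hratio : ∀ i, 0 < (![lam.toNNReal⁻¹, 1] : Fin 2 → ℝ≥0) i := fun i => by
    fin_cases i <;> simp [hlam]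
  have hmean : ∑ i, (PMF.uniformOfFintype (Fin 2) i).toReal *
      Real.log (![lam.toNNReal⁻¹, 1] i : ℝ≥0) = -(Real.log lam / 2) := by
    simp [hlam.le, div_eq_inv_mul]
  exact hmean ▸ hasLyapunovExponent_of_dist_eq _ hratio (dist_planarIFS hlam)

theorem contractsOnAverage_planarIFS (hlam : 1 < lam) :
    ContractsOnAverage (planarIFS α lam e) (PMF.uniformOfFintype (Fin 2)) :=
  ⟨fun i => ⟨_, .of_dist_le_mul fun x y => (dist_planarIFS (zero_lt_one.trans hlam) i x y).le⟩,
    _, neg_neg_of_pos (half_pos (Real.log_pos hlam)),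
    hasLyapunovExponent_planarIFS (zero_lt_one.trans hlam)⟩

variable {μ : Measure (EuclideanSpace ℝ (Fin 2))}

theorem IsStationaryMeasure.support_planarIFS
    (hμ : IsStationaryMeasure (planarIFS α lam e) (PMF.uniformOfFintype (Fin 2)) μ)
    (hα : Real.sin α ≠ 0) (he : e ≠ 0) (hlam : 1 < lam) : μ.support = Set.univ := by
  have := hμ.1
  have hlam0 : 0 < lam := zero_lt_one.trans hlam
  have hinv (i : Fin 2) : ∀ x ∈ μ.support, planarIFS α lam e i x ∈ μ.support := fun x hx =>
    hμ.map_mem_support (by simp) (continuous_planarIFS hlam0 i) hx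
  let ψ := Complex.orthonormalBasisOneI.repr
  have hpre : ψ ⁻¹' μ.support = Set.univ :=
    eq_univ_of_mul_mem_of_add_mem (ρ := planarMultiplier α lam) (ε := ψ.symm e)
      (Measure.isClosed_support.preimage ψ.continuous)
      ((Measure.nonempty_support (NeZero.ne μ)).preimage ψ.surjective)
      (by rw [norm_planarMultiplier hlam0.le]; exact inv_lt_one_of_one_lt₀ hlam)
      (planarMultiplier_im_ne_zero hlam0.ne' hα) (by simpa using he)
      (fun z hz => Set.mem_preimage.2 (planarIFS_zero_repr hlam0.ne' z ▸ hinv 0 _ hz))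
      fun z hz => by
        rw [Set.mem_preimage, map_add, ψ.apply_symm_apply]
        exact hinv 1 _ hz
  rw [← Set.image_preimage_eq μ.support ψ.surjective, hpre, Set.image_univ, ψ.surjective.range_eq]

theorem IsStationaryMeasure.measureDimH_planarIFS_le
    (hμ : IsStationaryMeasure (planarIFS α lam e) (PMF.uniformOfFintype (Fin 2)) μ)
    (hlam : 1 < lam) : measureDimH μ ≤ ENNReal.ofReal (2 * Real.log 2 / Real.log lam) := by
  have hlam0 : 0 < lam := zero_lt_one.trans hlam
  convert hμ.measureDimH_le (hasLyapunovExponent_planarIFS hlam0)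
    (neg_neg_of_pos (half_pos (Real.log_pos hlam)))
    fun i => (continuous_planarIFS hlam0 i).measurable using 2
  rw [Fintype.card_fin, neg_neg, div_div_eq_mul_div, mul_comm, Nat.cast_ofNat]

end PlanarIFS

theorem sin_ne_zero_of_irrational_div_pi {α : ℝ} (hα : Irrational (α / Real.pi)) :
    Real.sin α ≠ 0 := fun h =>
  let ⟨n, hn⟩ := Real.sin_eq_zero_iff.1 h
  hα ⟨n, by rw [← hn]; simp⟩

theorem mainTheorem6_general {α : ℝ} (hα : Real.sin α ≠ 0) {e : EuclideanSpace ℝ (Fin 2)}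
    (he : e ≠ 0) {lam : ℝ} (hlam : 1 < lam) :
    ContractsOnAverage (planarIFS α lam e) (PMF.uniformOfFintype (Fin 2)) ∧
    (∃! μ : Measure (EuclideanSpace ℝ (Fin 2)),
      IsStationaryMeasure (planarIFS α lam e) (PMF.uniformOfFintype (Fin 2)) μ) ∧
    ∀ μ : Measure (EuclideanSpace ℝ (Fin 2)),
      IsStationaryMeasure (planarIFS α lam e) (PMF.uniformOfFintype (Fin 2)) μ →
        μ.support = Set.univ ∧
        (2 < lam →
          μ ⟂ₘ volume ∧
          measureDimH μ ≤ ENNReal.ofReal (2 * Real.log 2 / Real.log lam) ∧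
          2 * Real.log 2 / Real.log lam < 2) := by
  have hcontr := contractsOnAverage_planarIFS (α := α) (e := e) hlam
  refine ⟨hcontr, existsUnique_isStationaryMeasure hcontr, fun μ hμ =>
    ⟨hμ.support_planarIFS hα he hlam, fun hlam2 => ?_⟩⟩
  have hdim := hμ.measureDimH_planarIFS_le hlam
  have hlt : 2 * Real.log 2 / Real.log lam < 2 := by
    rw [div_lt_iff₀ (Real.log_pos hlam)]
    gcongr
  refine ⟨mutuallySingular_of_measureDimH_lt_finrank (hdim.trans_lt ?_), hdim, hlt⟩
  rw [finrank_euclideanSpace_fin]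
  exact_mod_cast ENNReal.ofReal_lt_ofNat.2 hlt

theorem mainTheorem6 (α : ℝ) (hα : Irrational (α / Real.pi))
    (e : EuclideanSpace ℝ (Fin 2)) (he : ‖e‖ = 1) (lam : ℝ) (hlam : 1 < lam) :
    ContractsOnAverage (planarIFS α lam e) (PMF.uniformOfFintype (Fin 2)) ∧
    (∃! μ : Measure (EuclideanSpace ℝ (Fin 2)),
      IsStationaryMeasure (planarIFS α lam e) (PMF.uniformOfFintype (Fin 2)) μ) ∧
    ∀ μ : Measure (EuclideanSpace ℝ (Fin 2)),
      IsStationaryMeasure (planarIFS α lam e) (PMF.uniformOfFintype (Fin 2)) μ →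
        μ.support = Set.univ ∧
        (2 < lam →
          μ ⟂ₘ volume ∧
          measureDimH μ ≤ ENNReal.ofReal (2 * Real.log 2 / Real.log lam) ∧
          2 * Real.log 2 / Real.log lam < 2) := by
  exact mainTheorem6_general (sin_ne_zero_of_irrational_div_pi hα)
    (norm_ne_zero_iff.1 (he ▸ one_ne_zero)) hlam
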